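/- Consider an M/M/$s$ queue ($s\ge 1$) with service rate $\mu>0$ per server. For an arrival rate $\lambda\in[0,s\mu)$ let $W(s,\lambda)$ be the expected stationary waiting time of an arriving customer, including the time in service (so $W(s,\lambda)=\frac1\mu+\frac{C(s,\lambda)}{s\mu-\lambda}$ with $C$ the Erlang-C delay probability). Let $0\le\underline\lambda<m<\overline\lambda<s\mu$ and $0<\bar s<\frac{(\overline\lambda-m)^2(m-\underline\lambda)}{\overline\lambda-\underline\lambda}$, and let $\mathcal P$ be the set of all probability distributions $\mathbb P$ of $\Lambda$ with support contained in $[\underline\lambda,\overline\lambda]$, mean $\mathbb E_{\mathbb P}[\Lambda]=m$ and upper semivariance $\mathbb E_{\mathbb P}[(\max\{\Lambda-m,0\})^2]=\bar s$. For every $\mathbb P\in\mathcal P$ the expectation $\mathbb E_{\mathbb P}[W(s,\Lambda)]$ is finite, and the maximum of $\mathbb E_{\mathbb P}[W(s,\Lambda)]$ over $\mathbb P\in\mathcal P$ exists and equals the larger of the values of $\mathbb E_{\mathbb P}[W(s,\Lambda)]$ under the following two distributions, both of which belong to $\mathcal P$. (i) A three-point distribution $\mathbb P(\Lambda=\underline\lambda)=p_1(x_0^*)$,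 $\mathbb P(\Lambda=x_0^*)=p_2(x_0^*)$, $\mathbb P(\Lambda=\overline\lambda)=p_3(x_0^*)$. Here, for $x_0\in[m,\overline\lambda)$, the numbers $p_1,p_2,p_3$ are the unique solution of the moment equations $$p_1+p_2+p_3=1,\qquad p_1\underline\lambda+p_2x_0+p_3\overline\lambda=m,\qquad p_2(x_0-m)^2+p_3(\overline\lambda-m)^2=\bar s,$$ that is, $$p_2(x_0)=\frac{(m-\underline\lambda)(\overline\lambda-m)^2-\bar s(\overline\lambda-\underline\lambda)}{(x_0-\underline\lambda)(\overline\lambda-m)^2-(\overline\lambda-\underline\lambda)(x_0-m)^2},\qquad p_3(x_0)=\frac{\bar s(x_0-\underline\lambda)-(m-\underline\lambda)(x_0-m)^2}{(x_0-\underline\lambda)(\overline\lambda-m)^2-(\overline\lambda-\underline\lambda)(x_0-m)^2},$$ $p_1(x_0)=1-p_2(x_0)-p_3(x_0)$, and $x_0^*$ is any solution (at least one exists) of $$\max_{x_0\in[m,\overline\lambda)}\; p_1(x_0)W(s,\underline\lambda)+p_2(x_0)W(s,x_0)+p_3(x_0)W(s,\overline\lambda)\quad\text{s.t. } 0\le p_1(x_0),p_2(x_0),p_3(x_0)\le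 1 .$$ (ii) The two-point distribution $$\mathbb P(\Lambda=\underline\lambda)=\frac{\sqrt{4\bar s(m-\underline\lambda)^2+\bar s^2}-\bar s}{2(m-\underline\lambda)^2},\qquad \mathbb P(\Lambda=\tilde x_0)=\frac{2(m-\underline\lambda)^2}{\sqrt{4\bar s(m-\underline\lambda)^2+\bar s^2}+2(m-\underline\lambda)^2+\bar s},$$ $$\tilde x_0=\frac{2m(m-\underline\lambda)+\sqrt{4\bar s(m-\underline\lambda)^2+\bar s^2}+\bar s}{2(m-\underline\lambda)} .$$ -/

import Mathlib

open MeasureTheory Set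

noncomputable section

namespace MMS

/-! The M/M/s queue: Poisson arrivals with rate `lam`, `s` parallel servers, exponential service
with rate `mu` per server. -/

/-- Death rate of the number of customers in the system when `n` customers are present:
`min n s` servers are busy. -/
def deathRate (s : ℕ) (mu : ℝ) (n : ℕ) : ℝ := ((min n s : ℕ) : ℝ) * mu

/-- Unnormalised stationary weights of the birth-death process with birth rates `lam` and death
rates `deathRate s mu n`. -/
def weight (s : ℕ) (mu lam : ℝ) (n : ℕ) : ℝ :=
  ∏ k ∈ Finset.range n, lam / deathRate s mu (k + 1)

/-- Stationary probability of finding `n` customers in the system. -/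
def stationary (s : ℕ) (mu lam : ℝ) (n : ℕ) : ℝ :=
  weight s mu lam n / ∑' k, weight s mu lam k

/-- Mean time in the system (waiting plus service) of a customer who finds `n` customers on
arrival. With `n < s` there is only the own service; with `n ≥ s` the customer first waits for
`n + 1 - s` service completions, at total rate `s * mu`. (The subtraction of natural
numbers is truncated, as it should be.) -/
def sojournGiven (s : ℕ) (mu : ℝ) (n : ℕ) : ℝ :=
  ((n + 1 - s : ℕ) : ℝ) / (s * mu) + 1 / mu

/-- `W(s, lam)`: expected waiting time, including the time in service, of a customer who arrives
at the stationary M/M/s queue. -/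
def W (s : ℕ) (mu lam : ℝ) : ℝ :=
  ∑' n, stationary s mu lam n * sojournGiven s mu n

/-- The Erlang-C formula, for offered load `lam / mu` and utilisation `lam / (s * mu)`. -/
def erlangC (s : ℕ) (mu lam : ℝ) : ℝ :=
  ((lam / mu) ^ s / (s.factorial : ℝ) * (1 / (1 - lam / (s * mu)))) /
    (∑ k ∈ Finset.range s, (lam / mu) ^ k / (k.factorial : ℝ) +
      (lam / mu) ^ s / (s.factorial : ℝ) * (1 / (1 - lam / (s * mu))))

/-! Sanity facts: the stationary law is one, and `W` is the usual closed formula. -/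

section facts

variable {s : ℕ} {mu lam : ℝ}

theorem weight_nonneg (hmu : 0 < mu) (hl : 0 ≤ lam) (n : ℕ) : 0 ≤ weight s mu lam n := by
  unfold weight deathRate
  positivity

theorem weight_succ (n : ℕ) :
    weight s mu lam (n + 1) = weight s mu lam n * (lam / deathRate s mu (n + 1)) := by
  unfold weight
  rw [Finset.prod_range_succ]

theorem weight_of_le (hmu : 0 < mu) : ∀ n : ℕ, n ≤ s →
    weight s mu lam n = (lam / mu) ^ n / (n.factorial : ℝ)
  | 0, _ => by simp [weight]
  | n + 1, h => by
    rw [weight_succ, weight_of_le hmu n (by omega), deathRate, min_eq_left h, Nat.factorial_succ]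
    push_cast
    rw [pow_succ, div_mul_div_comm]
    simp only [div_eq_mul_inv, mul_inv]
    ring

theorem weight_add (hmu : 0 < mu) (j : ℕ) :
    weight s mu lam (j + s) =
      (lam / mu) ^ s / (s.factorial : ℝ) * (lam / (s * mu)) ^ j := by
  induction j with
  | zero => simpa using weight_of_le (lam := lam) hmu s le_rfl
  | succ j ih =>
    rw [show j + 1 + s = (j + s) + 1 by omega, weight_succ, ih, deathRate,
      min_eq_right (by omega), pow_succ]
    ring

theorem rho_nonneg (hmu : 0 < mu) (hl : 0 ≤ lam) : 0 ≤ lam / (s * mu) := by positivity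

theorem rho_lt_one (hs : 1 ≤ s) (hmu : 0 < mu) (hlt : lam < s * mu) :
    lam / (s * mu) < 1 := by
  have : (0 : ℝ) < s := by exact_mod_cast hs
  rwa [div_lt_one (by positivity)]

theorem hasSum_weight (hs : 1 ≤ s) (hmu : 0 < mu) (hl : 0 ≤ lam) (hlt : lam < s * mu) :
    HasSum (weight s mu lam)
      (∑ k ∈ Finset.range s, (lam / mu) ^ k / (k.factorial : ℝ) +
        (lam / mu) ^ s / (s.factorial : ℝ) * (1 / (1 - lam / (s * mu)))) := by
  have h1 : HasSum (fun j => weight s mu lam (j + s))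
      ((lam / mu) ^ s / (s.factorial : ℝ) * (1 / (1 - lam / (s * mu)))) := by
    simp only [weight_add hmu, one_div]
    exact (hasSum_geometric_of_lt_one (rho_nonneg hmu hl) (rho_lt_one hs hmu hlt)).mul_left _
  have h2 := (hasSum_nat_add_iff s).1 h1
  rw [add_comm] at h2
  rwa [Finset.sum_congr rfl fun k hk =>
    weight_of_le (lam := lam) hmu k (Finset.mem_range.1 hk).le] at h2

theorem tsum_weight_pos (hs : 1 ≤ s) (hmu : 0 < mu) (hl : 0 ≤ lam) (hlt : lam < s * mu) :
    0 < ∑' k, weight s mu lam k := by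
  refine (hasSum_weight hs hmu hl hlt).summable.tsum_pos (weight_nonneg hmu hl) 0 ?_
  simp [weight]

/-- The stationary probabilities sum to one. -/
theorem hasSum_stationary (hs : 1 ≤ s) (hmu : 0 < mu) (hl : 0 ≤ lam) (hlt : lam < s * mu) :
    HasSum (stationary s mu lam) 1 := by
  have h := (hasSum_weight hs hmu hl hlt).summable.hasSum.div_const (∑' k, weight s mu lam k)
  rwa [div_self (tsum_weight_pos hs hmu hl hlt).ne'] at h

/-- Flow balance between the states `n` and `n + 1`. -/
theorem stationary_balance (hs : 1 ≤ s) (hmu : 0 < mu) (n : ℕ) :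
    stationary s mu lam n * lam = stationary s mu lam (n + 1) * deathRate s mu (n + 1) := by
  have hd : deathRate s mu (n + 1) ≠ 0 := by
    have : 0 < min (n + 1) s := by omega
    have : (0 : ℝ) < ((min (n + 1) s : ℕ) : ℝ) := by exact_mod_cast this
    unfold deathRate
    positivity
  unfold stationary
  rw [weight_succ]
  field_simp

/-- The Erlang-C formula is the stationary probability that all servers are busy. -/
theorem hasSum_delay (hs : 1 ≤ s) (hmu : 0 < mu) (hl : 0 ≤ lam) (hlt : lam < s * mu) :
    HasSum (fun j => stationary s mu lam (j + s)) (erlangC s mu lam) := by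
  unfold stationary erlangC
  rw [← (hasSum_weight hs hmu hl hlt).tsum_eq]
  refine HasSum.div_const ?_ _
  simp only [weight_add hmu, one_div]
  exact (hasSum_geometric_of_lt_one (rho_nonneg hmu hl) (rho_lt_one hs hmu hlt)).mul_left _

/-- The series that defines `W` converges, to the usual closed formula. -/
theorem hasSum_W (hs : 1 ≤ s) (hmu : 0 < mu) (hl : 0 ≤ lam) (hlt : lam < s * mu) :
    HasSum (fun n => stationary s mu lam n * sojournGiven s mu n)
      (1 / mu + erlangC s mu lam / (s * mu - lam)) := by
  have hs0 : (0 : ℝ) < s := by exact_mod_cast hs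
  have hr0 := rho_nonneg (s := s) hmu hl
  have hr1 := rho_lt_one hs hmu hlt
  have hZ := tsum_weight_pos hs hmu hl hlt
  set r := lam / (s * mu) with hr
  set Z := ∑' k, weight s mu lam k with hZd
  have hg : HasSum (fun j : ℕ => ((j : ℝ) + 1) * r ^ j) (1 / (1 - r) ^ 2) := by
    have hn : ‖r‖ < 1 := by rwa [Real.norm_of_nonneg hr0]
    have h := (hasSum_coe_mul_geometric_of_norm_lt_one hn).add
      (hasSum_geometric_of_lt_one hr0 hr1)
    have h1 : 1 - r ≠ 0 := by linarith
    have e1 : (fun j : ℕ => ((j : ℝ) + 1) * r ^ j) = fun j : ℕ => (j : ℝ) * r ^ j + r ^ j := by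
      funext j
      ring
    have e2 : 1 / (1 - r) ^ 2 = r / (1 - r) ^ 2 + (1 - r)⁻¹ := by
      rw [inv_eq_one_div, div_add_div _ _ (pow_ne_zero 2 h1) h1, div_eq_div_iff
        (pow_ne_zero 2 h1) (mul_ne_zero (pow_ne_zero 2 h1) h1)]
      ring
    rw [e1, e2]
    exact h
  have hq : HasSum (fun n => stationary s mu lam n * (((n + 1 - s : ℕ) : ℝ) / (s * mu)))
      (erlangC s mu lam / (s * mu - lam)) := by
    have h1 : HasSum (fun j => stationary s mu lam (j + s) *
        (((j + s + 1 - s : ℕ) : ℝ) / (s * mu))) (erlangC s mu lam / (s * mu - lam)) := by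
      have h := hg.mul_left ((lam / mu) ^ s / (s.factorial : ℝ) / Z / (s * mu))
      have h1 : 1 - r ≠ 0 := by linarith
      have hE : erlangC s mu lam
          = (lam / mu) ^ s / (s.factorial : ℝ) * (1 / (1 - r)) / Z := by
        unfold erlangC
        rw [← (hasSum_weight hs hmu hl hlt).tsum_eq]
      have hd : s * mu - lam = s * mu * (1 - r) := by
        rw [hr]; field_simp
      rw [hE, hd]
      have e1 : (fun j => stationary s mu lam (j + s) * (((j + s + 1 - s : ℕ) : ℝ) / (s * mu)))
          = fun j : ℕ => (lam / mu) ^ s / (s.factorial : ℝ) / Z / (s * mu) *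
            (((j : ℝ) + 1) * r ^ j) := by
        funext j
        unfold stationary
        rw [weight_add hmu, show j + s + 1 - s = j + 1 by omega, ← hZd, ← hr]
        push_cast
        ring
      have e2 : (lam / mu) ^ s / (s.factorial : ℝ) * (1 / (1 - r)) / Z / (s * mu * (1 - r))
          = (lam / mu) ^ s / (s.factorial : ℝ) / Z / (s * mu) * (1 / (1 - r) ^ 2) := by
        generalize 1 - r = t
        simp only [div_eq_mul_inv, mul_inv, one_mul, sq]
        ring
      rw [e1, e2]
      exact h
    have h2 := (hasSum_nat_add_iff s
      (f := fun n => stationary s mu lam n * (((n + 1 - s : ℕ) : ℝ) / (s * mu)))).1 h1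
    rw [Finset.sum_eq_zero, add_zero] at h2
    · exact h2
    · intro k hk
      have : k + 1 - s = 0 := by have := Finset.mem_range.1 hk; omega
      simp [this]
  have h := ((hasSum_stationary hs hmu hl hlt).mul_right (1 / mu)).add hq
  rw [one_mul] at h
  have e : (fun n => stationary s mu lam n * sojournGiven s mu n) = fun n =>
      stationary s mu lam n * (1 / mu) +
        stationary s mu lam n * (((n + 1 - s : ℕ) : ℝ) / (s * mu)) := by
    funext n
    unfold sojournGiven
    ring
  rw [e]
  exact h

/-- `W` through the Erlang-C formula. -/
theorem W_eq (hs : 1 ≤ s) (hmu : 0 < mu) (hl : 0 ≤ lam) (hlt : lam < s * mu) :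
    W s mu lam = 1 / mu + erlangC s mu lam / (s * mu - lam) :=
  (hasSum_W hs hmu hl hlt).tsum_eq

/-- `lam * W` is the usual formula for the mean number in the system (Little's law). -/
theorem mul_W_eq (hs : 1 ≤ s) (hmu : 0 < mu) (hl : 0 ≤ lam) (hlt : lam < s * mu) :
    lam * W s mu lam = s * (lam / (s * mu)) +
      (lam / (s * mu)) / (1 - lam / (s * mu)) * erlangC s mu lam := by
  have hs0 : (0 : ℝ) < s := by exact_mod_cast hs
  have h1 : s * mu - lam ≠ 0 := by linarith
  have h2 : 1 - lam / (s * mu) ≠ 0 := by linarith [rho_lt_one hs hmu hlt]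
  have h3 : (lam / (s * mu)) / (1 - lam / (s * mu)) = lam / (s * mu - lam) := by
    field_simp
  rw [W_eq hs hmu hl hlt, h3]
  field_simp

end facts

/-! Laws of the arrival rate. -/

/-- The ambiguity set: probability laws on the line with support contained in `[lo, hi]`, mean `m`
and upper semivariance `E[((X - m)⁺)²] = v`. -/
def ambiguitySet (m v lo hi : ℝ) : Set (Measure ℝ) :=
  {P | IsProbabilityMeasure P ∧ P (Icc lo hi)ᶜ = 0 ∧ ∫ x, x ∂P = m ∧
    ∫ x, (max (x - m) 0) ^ 2 ∂P = v}

/-- Mass at `x` of the law on `{lo, x, hi}` with mean `m` and upper semivariance `v`, for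
`m ≤ x < hi`. -/
def p₂ (m v lo hi x : ℝ) : ℝ :=
  ((m - lo) * (hi - m) ^ 2 - v * (hi - lo)) /
    ((x - lo) * (hi - m) ^ 2 - (hi - lo) * (x - m) ^ 2)

/-- Mass at `hi` of that law. -/
def p₃ (m v lo hi x : ℝ) : ℝ :=
  (v * (x - lo) - (m - lo) * (x - m) ^ 2) /
    ((x - lo) * (hi - m) ^ 2 - (hi - lo) * (x - m) ^ 2)

/-- Mass at `lo` of that law. -/
def p₁ (m v lo hi x : ℝ) : ℝ := 1 - p₂ m v lo hi x - p₃ m v lo hi x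

/-- The law on `{lo, x, hi}`. -/
def threePointLaw (m v lo hi x : ℝ) : Measure ℝ :=
  ENNReal.ofReal (p₁ m v lo hi x) • Measure.dirac lo +
    ENNReal.ofReal (p₂ m v lo hi x) • Measure.dirac x +
      ENNReal.ofReal (p₃ m v lo hi x) • Measure.dirac hi

/-- Feasible middle points: those in `[m, hi)` for which the three masses lie in `[0, 1]`. -/
def feasible (m v lo hi : ℝ) : Set ℝ :=
  {x | x ∈ Ico m hi ∧ p₁ m v lo hi x ∈ Icc 0 1 ∧ p₂ m v lo hi x ∈ Icc 0 1 ∧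
    p₃ m v lo hi x ∈ Icc 0 1}

/-- Expected waiting time under the three-point law, as a function of the middle point. -/
def objective (s : ℕ) (mu m v lo hi x : ℝ) : ℝ :=
  p₁ m v lo hi x * W s mu lo + p₂ m v lo hi x * W s mu x + p₃ m v lo hi x * W s mu hi

/-- Mass at `lo` of the explicit two-point law. -/
def q₁ (m v lo : ℝ) : ℝ :=
  (√(4 * v * (m - lo) ^ 2 + v ^ 2) - v) / (2 * (m - lo) ^ 2)

/-- Mass at the upper point of the explicit two-point law. -/
def q₂ (m v lo : ℝ) : ℝ :=
  2 * (m - lo) ^ 2 / (√(4 * v * (m - lo) ^ 2 + v ^ 2) + 2 * (m - lo) ^ 2 + v)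

/-- Upper point of the explicit two-point law. -/
def upperPoint (m v lo : ℝ) : ℝ :=
  (2 * m * (m - lo) + √(4 * v * (m - lo) ^ 2 + v ^ 2) + v) / (2 * (m - lo))

/-- The explicit two-point law. -/
def twoPointLaw (m v lo : ℝ) : Measure ℝ :=
  ENNReal.ofReal (q₁ m v lo) • Measure.dirac lo +
    ENNReal.ofReal (q₂ m v lo) • Measure.dirac (upperPoint m v lo)

end MMS

end

namespace MMS

/-- The `s`-th partial sum of the exponential series. -/
noncomputable def expSum (s : ℕ) (a : ℝ) : ℝ := ∑ k ∈ Finset.range s, a ^ k / (k.factorial : ℝ)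

/-- Mean delay in the M/M/s queue in units of the mean service time, as a function of the offered
load `a`. -/
noncomputable def delay (s : ℕ) (a : ℝ) : ℝ :=
  s * (a ^ s / s.factorial) /
    (expSum s a * (s - a) ^ 2 + s * (a ^ s / s.factorial) * (s - a))

theorem expSum_pos {s : ℕ} (hs : 1 ≤ s) {a : ℝ} (ha : 0 ≤ a) : 0 < expSum s a := by
  obtain ⟨n, rfl⟩ : ∃ n, s = n + 1 := ⟨s - 1, by omega⟩
  unfold expSum
  rw [Finset.sum_range_succ']
  have : 0 ≤ ∑ k ∈ Finset.range n, a ^ (k + 1) / ((k + 1).factorial : ℝ) :=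
    Finset.sum_nonneg fun _ _ => by positivity
  simp
  linarith

theorem delay_den_pos {s : ℕ} (hs : 1 ≤ s) {a : ℝ} (ha : 0 ≤ a) (has : a < s) :
    0 < expSum s a * (s - a) ^ 2 + s * (a ^ s / s.factorial) * (s - a) := by
  have := expSum_pos hs ha
  have hd : 0 < (s : ℝ) - a := by linarith
  positivity

theorem delay_pos {s : ℕ} (hs : 1 ≤ s) {a : ℝ} (ha : 0 < a) (has : a < s) : 0 < delay s a := by
  have := delay_den_pos hs ha.le has
  have : (0 : ℝ) < s := by exact_mod_cast hs
  unfold delay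
  positivity

theorem W_eq_delay {s : ℕ} {mu lam : ℝ} (hs : 1 ≤ s) (hmu : 0 < mu) (hl : 0 ≤ lam)
    (hlt : lam < s * mu) : W s mu lam = 1 / mu + delay s (lam / mu) / mu := by
  have hs0 : (0 : ℝ) < s := by exact_mod_cast hs
  have hd : 0 < s * mu - lam := by linarith
  have ha : lam / mu < s := by rwa [div_lt_iff₀ hmu]
  have hden := delay_den_pos hs (div_nonneg hl hmu.le) ha
  have hS := expSum_pos hs (div_nonneg hl hmu.le)
  rw [W_eq hs hmu hl hlt]
  unfold delay erlangC
  change _ + (_ / (expSum s (lam / mu) + _)) / _ = _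
  set S := expSum s (lam / mu)
  set T := (lam / mu) ^ s / (s.factorial : ℝ) with hT
  have hT0 : 0 ≤ T := by positivity
  have e1 : 1 - lam / (s * mu) = (s - lam / mu) / s := by field_simp
  have e2 : s * mu - lam = mu * (s - lam / mu) := by field_simp
  rw [e1, e2]
  have hd' : 0 < s - lam / mu := by linarith
  set d := s - lam / mu
  have h3 : 0 < S * d + T * s := by positivity
  have h4 : S + T * (1 / (d / s)) = (S * d + T * s) / d := by field_simp
  have h5 : S * d ^ 2 + s * T * d = (S * d + T * s) * d := by ring
  rw [h4, h5]
  field_simp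

theorem hasDerivAt_expSum {s : ℕ} (hs : 1 ≤ s) (a : ℝ) (ha : a ≠ 0) :
    HasDerivAt (expSum s) (expSum s a - s * (a ^ s / s.factorial) / a) a := by
  induction s, hs using Nat.le_induction with
  | base =>
    have : expSum 1 = fun _ => 1 := by funext; simp [expSum]
    rw [this]
    exact (hasDerivAt_const a (1 : ℝ)).congr_deriv (by simp [ha])
  | succ n hn ih =>
    have : expSum (n + 1) = fun x => expSum n x + x ^ n / n.factorial := by
      funext x; simp [expSum, Finset.sum_range_succ]
    rw [this]
    refine (ih.add ((hasDerivAt_pow n a).div_const (n.factorial : ℝ))).congr_deriv ?_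
    obtain ⟨k, rfl⟩ : ∃ k, n = k + 1 := ⟨n - 1, by omega⟩
    rw [Nat.factorial_succ (k + 1)]
    push_cast
    field_simp
    ring

theorem continuousOn_delay {s : ℕ} (hs : 1 ≤ s) : ContinuousOn (delay s) (Ico 0 s) := by
  unfold delay expSum
  refine ContinuousOn.div (by fun_prop) (by fun_prop) fun a ha => ?_
  exact (delay_den_pos hs ha.1 ha.2).ne'

/-- The mean delay solves a Riccati equation with this coefficient. -/
noncomputable def growth (s a : ℝ) : ℝ := 2 / (s - a) + s / a - 1

theorem hasDerivAt_growth {s a : ℝ} (ha : a ≠ 0) (hd : s - a ≠ 0) :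
    HasDerivAt (growth s) (2 / (s - a) ^ 2 - s / a ^ 2) a := by
  unfold growth
  have h1 := (hasDerivAt_const a 2).fun_div ((hasDerivAt_id' a).const_sub s) hd
  have h2 := (hasDerivAt_const a s).fun_div (hasDerivAt_id' a) ha
  refine ((h1.fun_add h2).sub_const 1).congr_deriv ?_
  simp
  ring

theorem hasDerivAt_deriv_growth {s a : ℝ} (ha : a ≠ 0) (hd : s - a ≠ 0) :
    HasDerivAt (fun a => 2 / (s - a) ^ 2 - s / a ^ 2) (4 / (s - a) ^ 3 + 2 * s / a ^ 3) a := by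
  have h1 := (hasDerivAt_const a 2).fun_div (((hasDerivAt_id' a).const_sub s).fun_pow 2)
    (pow_ne_zero 2 hd)
  have h2 := (hasDerivAt_const a s).fun_div (hasDerivAt_pow 2 a) (pow_ne_zero 2 ha)
  refine (h1.fun_sub h2).congr_deriv ?_
  simp
  field_simp
  ring

theorem hasDerivAt_delay {s : ℕ} (hs : 1 ≤ s) {a : ℝ} (ha : 0 < a) (has : a < s) :
    HasDerivAt (delay s) (delay s a * (growth s a - delay s a)) a := by
  have hs0 : (0 : ℝ) < s := by exact_mod_cast hs
  have hden := delay_den_pos hs ha.le has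
  have hd : 0 < (s : ℝ) - a := by linarith
  have hT : HasDerivAt (fun x : ℝ => s * (x ^ s / s.factorial))
      (s * (s * (a ^ s / s.factorial) / a)) a := by
    refine (((hasDerivAt_pow s a).div_const (s.factorial : ℝ)).const_mul (s : ℝ)).congr_deriv ?_
    obtain ⟨k, rfl⟩ : ∃ k, s = k + 1 := ⟨s - 1, by omega⟩
    simp only [Nat.add_sub_cancel, pow_succ a k]
    field_simp
  have hsub := (hasDerivAt_id' a).const_sub (s : ℝ)
  have h := hT.fun_div
    (((hasDerivAt_expSum hs a ha.ne').fun_mul (hsub.fun_pow 2)).fun_add (hT.fun_mul hsub)) hden.ne'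
  refine h.congr_deriv ?_
  unfold delay growth
  have hD : expSum s a * (s - a) + a ^ s / s.factorial * s ≠ 0 := by
    have : 0 < (expSum s a * (s - a) + a ^ s / s.factorial * s) * (s - a) := by linarith
    exact (pos_of_mul_pos_left this hd.le).ne'
  generalize expSum s a = S at *
  generalize a ^ s / (s.factorial : ℝ) = T at *
  obtain ⟨d, hd'⟩ : ∃ d, d = (s : ℝ) - a := ⟨_, rfl⟩
  obtain ⟨D, hD'⟩ : ∃ D, D = S * d + T * s := ⟨_, rfl⟩
  rw [← hd', ← hD'] at hD
  have h5 : S * d ^ 2 + s * T * d = D * d := by rw [hD']; ring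
  have hs' : (s : ℝ) = d + a := by linarith
  rw [← hd'] at hd
  have hd0 := hd.ne'
  simp only [Nat.add_one_sub_one, pow_one, Nat.cast_ofNat, ← hd', h5]
  field_simp
  rw [hD', hs']
  ring

/-- Second derivative of the mean delay. -/
noncomputable def delayDeriv2 (s : ℕ) (a : ℝ) : ℝ :=
  delay s a * (growth s a ^ 2 - 3 * growth s a * delay s a + 2 * delay s a ^ 2 +
    (2 / (s - a) ^ 2 - s / a ^ 2))

/-- Third derivative of the mean delay. -/
noncomputable def delayDeriv3 (s : ℕ) (a : ℝ) : ℝ :=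
  delay s a * (growth s a ^ 3 - 7 * growth s a ^ 2 * delay s a + 12 * growth s a * delay s a ^ 2 -
    6 * delay s a ^ 3 + (3 * growth s a - 4 * delay s a) * (2 / (s - a) ^ 2 - s / a ^ 2) +
    (4 / (s - a) ^ 3 + 2 * s / a ^ 3))

theorem hasDerivAt_delayDeriv {s : ℕ} (hs : 1 ≤ s) {a : ℝ} (ha : 0 < a) (has : a < s) :
    HasDerivAt (fun a => delay s a * (growth s a - delay s a)) (delayDeriv2 s a) a := by
  have h1 := hasDerivAt_delay hs ha has
  have h2 := hasDerivAt_growth ha.ne' (sub_pos.2 has).ne'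
  refine (h1.mul (h2.sub h1)).congr_deriv ?_
  simp only [Pi.sub_apply, delayDeriv2]
  ring

theorem hasDerivAt_delayDeriv2 {s : ℕ} (hs : 1 ≤ s) {a : ℝ} (ha : 0 < a) (has : a < s) :
    HasDerivAt (delayDeriv2 s) (delayDeriv3 s a) a := by
  have h1 := hasDerivAt_delay hs ha has
  have h2 := hasDerivAt_growth ha.ne' (sub_pos.2 has).ne'
  have h3 := hasDerivAt_deriv_growth ha.ne' (sub_pos.2 has).ne'
  refine (h1.mul ((((h2.pow 2).sub ((h2.const_mul 3).mul h1)).add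
    ((h1.pow 2).const_mul 2)).add h3)).congr_deriv ?_
  simp only [Pi.sub_apply, Pi.add_apply, Pi.mul_apply, Pi.pow_apply, delayDeriv3]
  simp
  ring

theorem sub_mul_pow_div_factorial_le (n : ℕ) {a : ℝ} (ha : 0 ≤ a) :
    (n + 1 - a) * (a ^ n / n.factorial) ≤ expSum (n + 1) a := by
  induction n with
  | zero => simp [expSum, ha]
  | succ n ih =>
    have e : expSum (n + 1 + 1) a = expSum (n + 1) a + a ^ (n + 1) / (n + 1).factorial := by
      simp [expSum, Finset.sum_range_succ]
    have h : (n + 1 - a) * (a ^ n / n.factorial) -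
        (n + 1 - a) * (a ^ (n + 1) / (n + 1).factorial) =
        (n + 1 - a) ^ 2 * (a ^ n / (n + 1).factorial) := by
      rw [Nat.factorial_succ]; push_cast; field_simp; ring
    have : 0 ≤ (n + 1 - a) ^ 2 * (a ^ n / (n + 1).factorial) := by positivity
    rw [e]; push_cast
    linarith

/-- With `t` the probability of no delay, `t ≥ e / (1 + e)` for `e = (s - a) ^ 2 / a`. -/
theorem delay_bound {s : ℕ} (hs : 1 ≤ s) {a : ℝ} (ha : 0 < a) (has : a < s) :
    delay s a * (s - a) * (1 + (s - a) ^ 2 / a) ≤ 1 := by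
  obtain ⟨n, rfl⟩ : ∃ n, s = n + 1 := ⟨s - 1, by omega⟩
  have hd : 0 < ((n + 1 : ℕ) : ℝ) - a := by linarith
  have hden := delay_den_pos hs ha.le has
  have hb := sub_mul_pow_div_factorial_le n ha.le
  have hT : ((n + 1 : ℕ) : ℝ) * (a ^ (n + 1) / (n + 1).factorial) =
      a * (a ^ n / n.factorial) := by
    rw [Nat.factorial_succ, pow_succ]; push_cast; field_simp
  unfold delay
  rw [hT] at hden ⊢
  have e : ((n : ℝ) + 1 - a) = ((n + 1 : ℕ) : ℝ) - a := by push_cast; ring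
  rw [e] at hb
  set d := ((n + 1 : ℕ) : ℝ) - a
  set R := a ^ n / (n.factorial : ℝ)
  set S := expSum (n + 1) a
  have h1 : a * R / (S * d ^ 2 + a * R * d) * d * (1 + d ^ 2 / a) =
      (R * d * (a + d ^ 2)) / (S * d ^ 2 + a * R * d) := by field_simp
  rw [h1, div_le_one hden]
  nlinarith [mul_le_mul_of_nonneg_right hb (sq_nonneg d)]

theorem delay_mul_le_one {s : ℕ} (hs : 1 ≤ s) {a : ℝ} (ha : 0 < a) (has : a < s) :
    delay s a * (s - a) ≤ 1 := by
  have hd : 0 < (s : ℝ) - a := by linarith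
  have h := delay_bound hs ha has
  have := mul_pos (delay_pos hs ha has) hd
  have : 0 ≤ delay s a * (s - a) * ((s - a) ^ 2 / a) := by positivity
  linarith

theorem delayDeriv2_eq {s : ℕ} {a : ℝ} (ha : 0 < a) (has : a < s) :
    let d := s - a
    let t := 1 - delay s a * d
    let e := d ^ 2 / a
    delayDeriv2 s a = delay s a / d ^ 2 *
      (2 + 2 * t + 2 * t ^ 2 + 3 * e * t + e * (e - d / a)) := by
  intro d t e
  have hd : 0 < (s : ℝ) - a := by linarith
  have hs : (s : ℝ) = d + a := by simp [d]
  simp only [delayDeriv2, growth, t, e]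
  rw [show (s : ℝ) - a = d from rfl, hs]
  have hd' : 0 < d := hd
  clear_value d
  generalize delay s a = f
  field_simp
  ring

theorem delayDeriv3_eq {s : ℕ} {a : ℝ} (ha : 0 < a) (has : a < s) :
    let d := s - a
    let t := 1 - delay s a * d
    let e := d ^ 2 / a
    let x := d / a
    delayDeriv3 s a = delay s a / d ^ 3 *
      (6 * (1 + t + t ^ 2 + t ^ 3) + 12 * e * t ^ 2 + e ^ 2 * (7 * t - 4) + e ^ 3 +
        e * x * (2 * x - 3 * e - 4 * t)) := by
  intro d t e x
  have hd : 0 < (s : ℝ) - a := by linarith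
  have hs : (s : ℝ) = d + a := by simp [d]
  simp only [delayDeriv3, growth, t, e, x]
  rw [show (s : ℝ) - a = d from rfl, hs]
  have hd' : 0 < d := hd
  clear_value d
  generalize delay s a = f
  field_simp
  ring

theorem third_deriv_factor_nonneg {e x t : ℝ} (he : 0 < e) (hx : 0 < x) (ht0 : 0 ≤ t)
    (hte : e ≤ t * (1 + e)) (hex : 3 * x ^ 2 ≤ e * (1 + x)) :
    0 ≤ 6 * (1 + t + t ^ 2 + t ^ 3) + 12 * e * t ^ 2 + e ^ 2 * (7 * t - 4) + e ^ 3 +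
        e * x * (2 * x - 3 * e - 4 * t) := by
  have ht2 : 0 ≤ t ^ 2 := sq_nonneg t
  have ht3 : 0 ≤ t ^ 3 := pow_nonneg ht0 3
  have het2 : 0 ≤ e * t ^ 2 := mul_nonneg he.le ht2
  rcases le_or_gt (2 * x) e with h | h
  · have h1 : 0 ≤ e * ((e - x) * (e - 2 * x)) :=
      mul_nonneg he.le (mul_nonneg (by linarith) (by linarith))
    have h2 : 0 ≤ e * t * (e - 2 * x) := mul_nonneg (by positivity) (by linarith)
    have h3 : 0 ≤ 6 + 5 * e ^ 2 * t - 4 * e ^ 2 := by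
      have h4 : 0 ≤ (6 + 5 * e ^ 2 * t - 4 * e ^ 2) * (1 + e) := by
        have := mul_le_mul_of_nonneg_left hte (sq_nonneg e)
        have : 0 ≤ e * (e - 2) ^ 2 := by positivity
        nlinarith
      exact nonneg_of_mul_nonneg_left h4 (by linarith)
    nlinarith
  · have hx2 : x < 2 := by nlinarith
    rcases le_or_gt e x with h' | h'
    · have hxh : x ≤ 1 / 2 := by nlinarith
      have h1 : 0 ≤ e * ((x - e) * (2 * x - e)) :=
        mul_nonneg he.le (mul_nonneg (by linarith) (by linarith))
      have h2 : e * x ≤ 1 / 4 := by nlinarith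
      have h3 : e * e ≤ 1 / 4 := by nlinarith
      have h4 : 0 ≤ e ^ 2 * t := by positivity
      nlinarith [mul_le_mul_of_nonneg_right h2 ht0]
    · have h1 : e * ((e - x) * (2 * x - e)) ≤ e * (e * (1 + e) / 12) := by
        refine mul_le_mul_of_nonneg_left ?_ he.le
        nlinarith [sq_nonneg (2 * e - 3 * x)]
      have h2 : e * t * x ≤ e * t * e := mul_le_mul_of_nonneg_left h'.le (by positivity)
      have h3 : 0 ≤ 6 + 6 * t + 12 * e * t ^ 2 + 3 * e ^ 2 * t - 4 * e ^ 2 -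
          e ^ 2 * (1 + e) / 12 := by
        have h4 : 0 ≤ (6 + 6 * t + 12 * e * t ^ 2 + 3 * e ^ 2 * t - 4 * e ^ 2 -
            e ^ 2 * (1 + e) / 12) * (1 + e) ^ 2 := by
          have i0 : 0 ≤ t * (1 + e) - e := by linarith
          have i1 : 0 ≤ (6 + 3 * e ^ 2) * (1 + e) * (t * (1 + e) - e) := by positivity
          have i2 : 0 ≤ 12 * e * ((t * (1 + e) - e) * (t * (1 + e) + e)) := by positivity
          have he4 : 0 ≤ 4 - e := by linarith
          have i3 : 0 ≤ e ^ 3 * (4 - e) := by positivity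
          have i4 : 0 ≤ e ^ 3 * (4 - e) * (4 + e) := by positivity
          have i5 : 0 < e ^ 3 := by positivity
          nlinarith
        exact nonneg_of_mul_nonneg_left h4 (by positivity)
      nlinarith

theorem delayDeriv2_pos {s : ℕ} (hs : 1 ≤ s) {a : ℝ} (ha : 0 < a) (has : a < s) :
    0 < delayDeriv2 s a := by
  have hd : 0 < (s : ℝ) - a := by linarith
  have hf := delay_pos hs ha has
  rw [delayDeriv2_eq ha has]
  refine mul_pos (by positivity) ?_
  obtain rfl | h2 := hs.eq_or_lt
  · have e1 : delay 1 a * ((1 : ℕ) - a) = a := by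
      simp at hd
      have : 1 - a ≠ 0 := sub_ne_zero.2 hd.ne'
      have h3 : (1 - a) ^ 2 + a * (1 - a) = 1 - a := by ring
      simp [delay, expSum, h3]
      field_simp
    rw [e1]
    simp at hd ⊢
    have e2 : 2 + 2 * (1 - a) + 2 * (1 - a) ^ 2 + 3 * ((1 - a) ^ 2 / a) * (1 - a) +
        (1 - a) ^ 2 / a * ((1 - a) ^ 2 / a - (1 - a) / a) = 2 / a := by
      field_simp
      ring
    rw [e2]
    positivity
  · have ht := delay_mul_le_one hs ha has
    have hs2 : (2 : ℝ) ≤ s := by exact_mod_cast h2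
    have ht' : 0 ≤ 1 - delay s a * (s - a) := by linarith
    have he : 0 < ((s : ℝ) - a) ^ 2 / a := by positivity
    have hx : 0 < ((s : ℝ) - a) / a := by positivity
    have hex : 2 * (((s : ℝ) - a) / a) ^ 2 ≤ ((s : ℝ) - a) ^ 2 / a * (1 + ((s : ℝ) - a) / a) := by
      have : ((s : ℝ) - a) ^ 2 / a * (1 + ((s : ℝ) - a) / a) = s * (((s : ℝ) - a) / a) ^ 2 := by
        field_simp
        ring
      rw [this]
      exact mul_le_mul_of_nonneg_right hs2 (sq_nonneg _)
    generalize 1 - delay s a * (s - a) = t at *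
    generalize ((s : ℝ) - a) ^ 2 / a = e at *
    generalize ((s : ℝ) - a) / a = x at *
    have h5 : 0 ≤ e * t := by positivity
    rcases le_or_gt x e with h | h
    · have := mul_nonneg he.le (sub_nonneg.2 h)
      nlinarith
    · have : x < 1 := by nlinarith
      nlinarith

theorem delayDeriv3_nonneg {s : ℕ} (hs : 1 ≤ s) {a : ℝ} (ha : 0 < a) (has : a < s) :
    0 ≤ delayDeriv3 s a := by
  have hd : 0 < (s : ℝ) - a := by linarith
  have hf := delay_pos hs ha has
  obtain rfl | h2 := hs.eq_or_lt
  · have e1 : delay 1 a = a / (1 - a) := by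
      have h3 : (1 - a) ^ 2 + a * (1 - a) = 1 - a := by ring
      simp [delay, expSum, h3]
    simp at hd
    have : delayDeriv3 1 a = 6 / (1 - a) ^ 4 := by
      simp only [delayDeriv3, growth, e1, Nat.cast_one]
      have : 1 - a ≠ 0 := sub_ne_zero.2 hd.ne'
      field_simp
      ring
    rw [this]
    positivity
  obtain rfl | h3 := (Nat.succ_le_of_lt h2).eq_or_lt
  · norm_num at hd
    have e1 : delay 2 a = a ^ 2 / ((2 - a) * (2 + a)) := by
      have h3 : (1 + a) * (2 - a) ^ 2 + a ^ 2 * (2 - a) = (2 - a) * (2 + a) := by ring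
      simp [delay, expSum, Finset.sum_range_succ]
      rw [mul_div_cancel₀ _ two_ne_zero, h3]
    have : delayDeriv3 2 a = 96 * a * (4 + a ^ 2) / ((2 - a) * (2 + a)) ^ 4 := by
      simp only [delayDeriv3, growth, e1, Nat.cast_ofNat]
      have : 2 - a ≠ 0 := by linarith
      field_simp
      ring
    rw [this]
    have : 0 < 2 - a := by linarith
    positivity
  rw [delayDeriv3_eq ha has]
  have hs3 : (3 : ℝ) ≤ s := by exact_mod_cast h3
  refine mul_nonneg (by positivity) (third_deriv_factor_nonneg (by positivity) (by positivity)
    ?_ ?_ ?_)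
  · linarith [delay_mul_le_one hs ha has]
  · linarith [delay_bound hs ha has]
  · have : ((s : ℝ) - a) ^ 2 / a * (1 + ((s : ℝ) - a) / a) = s * (((s : ℝ) - a) / a) ^ 2 := by
      field_simp
      ring
    rw [this]
    exact mul_le_mul_of_nonneg_right hs3 (sq_nonneg _)

end MMS

namespace MMS

/-- A function with antitone second derivative that has a double zero at `x` and is nonnegative at
the right end of an interval is nonnegative on the interval. -/
theorem nonneg_of_antitone_deriv2 {h h1 h2 : ℝ → ℝ} {c d x : ℝ}
    (hh : ∀ y ∈ Icc c d, HasDerivAt h (h1 y) y) (hh1 : ∀ y ∈ Icc c d, HasDerivAt h1 (h2 y) y)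
    (hanti : AntitoneOn h2 (Icc c d)) (hx : x ∈ Ico c d) (hx0 : h x = 0) (hx1 : h1 x = 0)
    (hd : 0 ≤ h d) : ∀ y ∈ Icc c d, 0 ≤ h y := by
  have mvt : ∀ {p p' : ℝ → ℝ} (_ : ∀ y ∈ Icc c d, HasDerivAt p (p' y) y) {u w : ℝ},
      c ≤ u → u < w → w ≤ d → ∃ z ∈ Ioo u w, p' z = (p w - p u) / (w - u) := by
    intro p p' hp u w hu huw hw
    exact exists_hasDerivAt_eq_slope p p' huw
      (fun y hy => (hp y ⟨hu.trans hy.1, hy.2.trans hw⟩).continuousAt.continuousWithinAt)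
      (fun y hy => hp y ⟨hu.trans hy.1.le, hy.2.le.trans hw⟩)
  intro y hy
  by_contra! hneg
  obtain ⟨hcx, hxd⟩ := hx
  obtain ⟨hcy, hyd⟩ := hy
  rcases lt_trichotomy y x with hyx | rfl | hxy
  · obtain ⟨z, hz, ez⟩ := mvt hh hcy hyx hxd.le
    obtain ⟨w, hw, ew⟩ := mvt hh1 (hcy.trans hz.1.le) hz.2 hxd.le
    have hz0 : 0 < h1 z := by rw [ez, hx0]; exact div_pos (by linarith) (by linarith)
    have hw0 : h2 w < 0 := by
      rw [ew, hx1]; exact div_neg_of_neg_of_pos (by linarith) (by linarith [hz.2])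
    obtain ⟨z', hz', ez'⟩ := mvt hh hcx hxd le_rfl
    obtain ⟨w', hw', ew'⟩ := mvt hh1 hcx hz'.1 hz'.2.le
    have hz0' : 0 ≤ h1 z' := by rw [ez', hx0]; exact div_nonneg (by linarith) (by linarith)
    have hw0' : 0 ≤ h2 w' := by
      rw [ew', hx1]; exact div_nonneg (by linarith) (by linarith [hz'.1])
    have := hanti ⟨by linarith [hz.1, hw.1], by linarith [hw.2]⟩
      ⟨by linarith [hw'.1], by linarith [hw'.2, hz'.2]⟩ (hw.2.trans hw'.1).le
    linarith
  · linarith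
  · have hyd' : y < d := lt_of_le_of_ne hyd (by rintro rfl; linarith)
    obtain ⟨z, hz, ez⟩ := mvt hh hcx hxy hyd
    obtain ⟨w, hw, ew⟩ := mvt hh1 hcx hz.1 (hz.2.le.trans hyd)
    have hz0 : h1 z < 0 := by
      rw [ez, hx0]; exact div_neg_of_neg_of_pos (by linarith) (by linarith)
    have hw0 : h2 w < 0 := by
      rw [ew, hx1]; exact div_neg_of_neg_of_pos (by linarith) (by linarith [hz.1])
    obtain ⟨z', hz', ez'⟩ := mvt hh hcy hyd' le_rfl
    have hz0' : 0 < h1 z' := by rw [ez']; exact div_pos (by linarith) (by linarith)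
    obtain ⟨w', hw', ew'⟩ := mvt hh1 (hcx.trans hz.1.le) (hz.2.trans hz'.1) hz'.2.le
    have hw0' : 0 < h2 w' := by
      rw [ew']; exact div_pos (by linarith) (by linarith [hz.2, hz'.1])
    have := hanti ⟨by linarith [hw.1], by linarith [hw.2, hz.2]⟩
      ⟨by linarith [hw'.1, hz.1], by linarith [hw'.2, hz'.2]⟩ (hw.2.trans hw'.1).le
    linarith

/-- Existence of a dual solution: a function that is affine on the left of `m` and quadratic on
the right, dominates `F`, and touches it at `lo` and at a point `x ≤ u`, and also at `hi` unless
`x = u`. -/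
theorem exists_dual_majorant {F F1 F2 : ℝ → ℝ} {lo m u hi : ℝ} (hm : lo < m) (hmu : m < u)
    (hu : u < hi) (hc : ContinuousOn F (Icc lo hi))
    (hF : ∀ y ∈ Ioc lo hi, HasDerivAt F (F1 y) y) (hF1 : ∀ y ∈ Ioc lo hi, HasDerivAt F1 (F2 y) y)
    (hpos : ∀ y ∈ Ioo lo hi, 0 < F2 y) (hmono : MonotoneOn F2 (Icc m hi)) :
    ∃ x ∈ Icc m u, ∃ b c : ℝ,
      F x = F lo + b * (x - lo) + c * (x - m) ^ 2 ∧
      (F hi = F lo + b * (hi - lo) + c * (hi - m) ^ 2 ∨ x = u) ∧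
      ∀ y ∈ Icc lo hi, F y ≤ F lo + b * (y - lo) + c * (max (y - m) 0) ^ 2 := by
  have hconv : StrictConvexOn ℝ (Icc lo hi) F := by
    refine strictConvexOn_of_deriv2_pos (convex_Icc _ _) hc fun y hy => ?_
    rw [interior_Icc] at hy
    have e : deriv F =ᶠ[nhds y] F1 := by
      filter_upwards [Ioo_mem_nhds hy.1 hy.2] with z hz using (hF z ⟨hz.1, hz.2.le⟩).deriv
    simp only [Function.iterate_succ, Function.iterate_zero, Function.comp_apply, id]
    rw [e.deriv_eq, (hF1 y ⟨hy.1, hy.2.le⟩).deriv]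
    exact hpos y hy
  -- the coefficients of tangency at `x` are `b' x / D x` and `c' x / D x`
  let D : ℝ → ℝ := fun x => (x - m) * (x + m - 2 * lo)
  let c' : ℝ → ℝ := fun x => F1 x * (x - lo) - (F x - F lo)
  let b' : ℝ → ℝ := fun x => F1 x * D x - 2 * c' x * (x - m)
  let G : ℝ → ℝ := fun x => b' x * (hi - lo) + c' x * (hi - m) ^ 2 - D x * (F hi - F lo)
  have hsub : Icc m u ⊆ Ioc lo hi := fun y hy => ⟨hm.trans_le hy.1, hy.2.trans hu.le⟩
  have hGc : ContinuousOn G (Icc m u) := by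
    have h0 : ContinuousOn F (Icc m u) :=
      fun y hy => (hF y (hsub hy)).continuousAt.continuousWithinAt
    have h1 : ContinuousOn F1 (Icc m u) :=
      fun y hy => (hF1 y (hsub hy)).continuousAt.continuousWithinAt
    simp only [G, b', c', D]
    fun_prop
  have hGm : 0 < G m := by
    have h1 := hconv.slope_lt_of_hasDerivAt (x := lo) (y := m) ⟨le_rfl, by linarith⟩
      ⟨hm.le, by linarith⟩ hm (hF m ⟨hm, by linarith⟩)
    rw [slope_def_field, div_lt_iff₀ (by linarith)] at h1
    have : 0 < c' m * (hi - m) ^ 2 :=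
      mul_pos (by simp only [c']; linarith) (pow_pos (by linarith) 2)
    simp only [G, b', D]
    linarith
  obtain ⟨x, hx, hxG⟩ : ∃ x ∈ Ioc m u, 0 ≤ G x ∧ (G x = 0 ∨ x = u) := by
    by_cases h : 0 ≤ G u
    · exact ⟨u, ⟨hmu, le_rfl⟩, h, Or.inr rfl⟩
    · obtain ⟨x, hx, hx0⟩ := intermediate_value_Icc' hmu.le hGc (show (0 : ℝ) ∈ Icc (G u) (G m) from
        ⟨by linarith, hGm.le⟩)
      refine ⟨x, ⟨lt_of_le_of_ne hx.1 ?_, hx.2⟩, hx0.ge, Or.inl hx0⟩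
      rintro rfl
      linarith
  have hD : 0 < D x := mul_pos (by linarith [hx.1]) (by linarith [hx.1])
  set b := b' x / D x
  set c := c' x / D x
  have hbD : b * D x = b' x := div_mul_cancel₀ _ hD.ne'
  have hcD : c * D x = c' x := div_mul_cancel₀ _ hD.ne'
  have hval : F x = F lo + b * (x - lo) + c * (x - m) ^ 2 := by
    refine mul_right_cancel₀ hD.ne' ?_
    have : (F lo + b * (x - lo) + c * (x - m) ^ 2) * D x =
      F lo * D x + b * D x * (x - lo) + c * D x * (x - m) ^ 2 := by ring
    rw [this, hbD, hcD]
    simp only [b', c', D]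
    ring
  have hder : F1 x = b + 2 * c * (x - m) := by
    refine mul_right_cancel₀ hD.ne' ?_
    have : (b + 2 * c * (x - m)) * D x = b * D x + 2 * (c * D x) * (x - m) := by ring
    rw [this, hbD, hcD]
    simp only [b']
    ring
  have hGx : G x = (F lo + b * (hi - lo) + c * (hi - m) ^ 2 - F hi) * D x := by
    have : (F lo + b * (hi - lo) + c * (hi - m) ^ 2 - F hi) * D x =
      b * D x * (hi - lo) + c * D x * (hi - m) ^ 2 - D x * (F hi - F lo) := by ring
    rw [this, hbD, hcD]
  have hright : ∀ y ∈ Icc m hi, 0 ≤ F lo + b * (y - lo) + c * (y - m) ^ 2 - F y := by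
    refine nonneg_of_antitone_deriv2 (h := fun y => F lo + b * (y - lo) + c * (y - m) ^ 2 - F y)
      (h1 := fun y => b + 2 * c * (y - m) - F1 y) (h2 := fun y => 2 * c - F2 y) (x := x)
      (fun y hy => ?_) (fun y hy => ?_) (fun y hy z hz hyz => ?_) ⟨hx.1.le, hx.2.trans_lt hu⟩
      ?_ ?_ ?_
    · have h1 := ((((hasDerivAt_id' y).sub_const lo).const_mul b).const_add (F lo)).fun_add
        ((((hasDerivAt_id' y).sub_const m).fun_pow 2).const_mul c)
      refine (h1.fun_sub (hF y ⟨hm.trans_le hy.1, hy.2⟩)).congr_deriv ?_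
      simp
      ring
    · have h1 := (((hasDerivAt_id' y).sub_const m).const_mul (2 * c)).const_add b
      refine (h1.fun_sub (hF1 y ⟨hm.trans_le hy.1, hy.2⟩)).congr_deriv ?_
      ring
    · linarith [hmono hy hz hyz]
    · linarith
    · linarith
    · exact nonneg_of_mul_nonneg_left (hGx ▸ hxG.1) hD
  refine ⟨x, ⟨hx.1.le, hx.2⟩, b, c, hval, ?_, fun y hy => ?_⟩
  · refine hxG.2.imp_left fun h0 => ?_
    rw [hGx] at h0
    have := (mul_eq_zero.1 h0).resolve_right hD.ne'
    linarith
  · rcases le_total m y with hmy | hym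
    · rw [max_eq_left (by linarith)]
      linarith [hright y ⟨hmy, hy.2⟩]
    · rw [max_eq_right (by linarith)]
      have h1 := hright m ⟨le_rfl, by linarith⟩
      have hml : 0 < m - lo := by linarith
      have h2 := hconv.convexOn.2 (show lo ∈ Icc lo hi from ⟨le_rfl, by linarith⟩)
        (show m ∈ Icc lo hi from ⟨hm.le, by linarith⟩)
        (show 0 ≤ (m - y) / (m - lo) from div_nonneg (by linarith) (by linarith))
        (show 0 ≤ (y - lo) / (m - lo) from div_nonneg (by linarith [hy.1]) (by linarith))
        (by field_simp; ring)
      have e : ((m - y) / (m - lo)) • lo + ((y - lo) / (m - lo)) • m = y := by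
        simp only [smul_eq_mul]; field_simp; ring
      rw [e] at h2
      simp only [smul_eq_mul] at h2
      have h3 : (y - lo) / (m - lo) * F m ≤ (y - lo) / (m - lo) * (F lo + b * (m - lo)) :=
        mul_le_mul_of_nonneg_left (by linarith)
          (div_nonneg (by linarith [hy.1]) (by linarith))
      have e2 : (m - y) / (m - lo) * F lo + (y - lo) / (m - lo) * (F lo + b * (m - lo)) =
        F lo + b * (y - lo) := by field_simp; ring
      linarith

end MMS

namespace MMS

theorem monotoneOn_delayDeriv2 {s : ℕ} (hs : 1 ≤ s) : MonotoneOn (delayDeriv2 s) (Ioo 0 s) := by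
  have hd : ∀ a ∈ Ioo (0 : ℝ) s, HasDerivAt (delayDeriv2 s) (delayDeriv3 s a) a :=
    fun a ha => hasDerivAt_delayDeriv2 hs ha.1 ha.2
  refine monotoneOn_of_deriv_nonneg (convex_Ioo _ _)
    (fun a ha => (hd a ha).continuousAt.continuousWithinAt) ?_ ?_ <;> rw [interior_Ioo]
  · exact fun a ha => (hd a ha).differentiableAt.differentiableWithinAt
  · intro a ha
    rw [(hd a ha).deriv]
    exact delayDeriv3_nonneg hs ha.1 ha.2

section queue

variable {s : ℕ} {mu : ℝ}

theorem div_mem_Ioo {y : ℝ} (hmu : 0 < mu) (hy : y ∈ Ioo 0 (s * mu)) : y / mu ∈ Ioo (0 : ℝ) s :=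
  ⟨div_pos hy.1 hmu, (div_lt_iff₀ hmu).2 hy.2⟩

theorem continuousOn_W (hs : 1 ≤ s) (hmu : 0 < mu) : ContinuousOn (W s mu) (Ico 0 (s * mu)) := by
  have h : ContinuousOn (fun y => 1 / mu + delay s (y / mu) / mu) (Ico 0 (s * mu)) := by
    refine continuousOn_const.add (ContinuousOn.div_const ?_ _)
    exact (continuousOn_delay hs).comp (by fun_prop) fun y hy =>
      ⟨div_nonneg hy.1 hmu.le, (div_lt_iff₀ hmu).2 hy.2⟩
  exact h.congr fun y hy => W_eq_delay hs hmu hy.1 hy.2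

theorem hasDerivAt_W (hs : 1 ≤ s) (hmu : 0 < mu) {y : ℝ} (hy : y ∈ Ioo 0 (s * mu)) :
    HasDerivAt (W s mu)
      (delay s (y / mu) * (growth s (y / mu) - delay s (y / mu)) / mu ^ 2) y := by
  have ha := div_mem_Ioo hmu hy
  have h := (((hasDerivAt_delay hs ha.1 ha.2).comp y
    ((hasDerivAt_id' y).div_const mu)).div_const mu).const_add (1 / mu)
  refine (h.congr_of_eventuallyEq ?_).congr_deriv (by field_simp)
  filter_upwards [Ioo_mem_nhds hy.1 hy.2] with z hz using W_eq_delay hs hmu hz.1.le hz.2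

theorem hasDerivAt_deriv_W (hs : 1 ≤ s) (hmu : 0 < mu) {y : ℝ} (hy : y ∈ Ioo 0 (s * mu)) :
    HasDerivAt (fun y => delay s (y / mu) * (growth s (y / mu) - delay s (y / mu)) / mu ^ 2)
      (delayDeriv2 s (y / mu) / mu ^ 3) y := by
  have ha := div_mem_Ioo hmu hy
  have h := ((hasDerivAt_delayDeriv hs ha.1 ha.2).comp y
    ((hasDerivAt_id' y).div_const mu)).div_const (mu ^ 2)
  exact h.congr_deriv (by field_simp)

end queue

section laws

theorem integral_two_dirac (g : ℝ → ℝ) {a b : ℝ} (ha : 0 ≤ a) (hb : 0 ≤ b) (x y : ℝ) :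
    Integrable g (ENNReal.ofReal a • Measure.dirac x + ENNReal.ofReal b • Measure.dirac y) ∧
    ∫ l, g l ∂(ENNReal.ofReal a • Measure.dirac x + ENNReal.ofReal b • Measure.dirac y) =
      a * g x + b * g y := by
  have hi : ∀ (c z : ℝ), Integrable g (ENNReal.ofReal c • Measure.dirac z) := fun c z =>
    (integrable_dirac (by simp)).smul_measure ENNReal.ofReal_ne_top
  refine ⟨(hi a x).add_measure (hi b y), ?_⟩
  rw [integral_add_measure (hi a x) (hi b y)]
  simp [integral_smul_measure, ENNReal.toReal_ofReal ha, ENNReal.toReal_ofReal hb]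

theorem integral_three_dirac (g : ℝ → ℝ) {a b c : ℝ} (ha : 0 ≤ a) (hb : 0 ≤ b) (hc : 0 ≤ c)
    (x y z : ℝ) :
    ∫ l, g l ∂(ENNReal.ofReal a • Measure.dirac x + ENNReal.ofReal b • Measure.dirac y +
      ENNReal.ofReal c • Measure.dirac z) = a * g x + b * g y + c * g z := by
  obtain ⟨h1, h2⟩ := integral_two_dirac g ha hb x y
  rw [integral_add_measure h1 ((integrable_dirac (by simp)).smul_measure ENNReal.ofReal_ne_top), h2]
  simp [integral_smul_measure, ENNReal.toReal_ofReal hc]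

theorem threePoint_mem {m v lo hi a b c x : ℝ} (hlo : lo < m) (hx : m ≤ x) (hxhi : x < hi)
    (ha : 0 ≤ a) (hb : 0 ≤ b) (hc : 0 ≤ c) (h0 : a + b + c = 1)
    (h1 : a * lo + b * x + c * hi = m) (h2 : b * (x - m) ^ 2 + c * (hi - m) ^ 2 = v) :
    ENNReal.ofReal a • Measure.dirac lo + ENNReal.ofReal b • Measure.dirac x +
      ENNReal.ofReal c • Measure.dirac hi ∈ ambiguitySet m v lo hi := by
  refine ⟨⟨?_⟩, ?_, ?_, ?_⟩
  · simp [← ENNReal.ofReal_add, ha, hb, hc, add_nonneg, h0]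
  · have hn : ∀ y ∈ Icc lo hi, y ∉ (Icc lo hi)ᶜ := fun y hy h => h hy
    have hS : MeasurableSet (Icc lo hi)ᶜ := measurableSet_Icc.compl
    simp only [Measure.add_apply, Measure.smul_apply, Measure.dirac_apply' _ hS]
    rw [indicator_of_notMem (hn lo ⟨le_rfl, by linarith⟩),
      indicator_of_notMem (hn x ⟨by linarith, hxhi.le⟩),
      indicator_of_notMem (hn hi ⟨by linarith, le_rfl⟩)]
    simp
  · rw [integral_three_dirac _ ha hb hc, h1]
  · rw [integral_three_dirac _ ha hb hc, max_eq_right (by linarith), max_eq_left (by linarith),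
      max_eq_left (by linarith), ← h2]
    ring

variable {m v lo hi : ℝ}

theorem threePoint_den_pos (hlo : lo < m) {x : ℝ} (hx : m ≤ x) (hxhi : x < hi) :
    0 < (x - lo) * (hi - m) ^ 2 - (hi - lo) * (x - m) ^ 2 := by
  have e : (x - lo) * (hi - m) ^ 2 - (hi - lo) * (x - m) ^ 2 =
    (hi - x) * ((m - lo) * (hi + x - 2 * m) + (x - m) * (hi - m)) := by ring
  rw [e]
  refine mul_pos (by linarith) (add_pos_of_pos_of_nonneg (mul_pos (by linarith) (by linarith))
    (mul_nonneg (by linarith) (by linarith)))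

theorem moment_equations_iff (hlo : lo < m) {x : ℝ} (hx : m ≤ x) (hxhi : x < hi) (a b c : ℝ) :
    (a + b + c = 1 ∧ a * lo + b * x + c * hi = m ∧
        b * (x - m) ^ 2 + c * (hi - m) ^ 2 = v) ↔
      (a = p₁ m v lo hi x ∧ b = p₂ m v lo hi x ∧ c = p₃ m v lo hi x) := by
  have hD := threePoint_den_pos hlo hx hxhi
  constructor
  · rintro ⟨h0, h1, h2⟩
    have hb : b = p₂ m v lo hi x := by
      rw [p₂, eq_div_iff hD.ne']
      linear_combination (hi - m) ^ 2 * h1 - (hi - m) ^ 2 * lo * h0 - (hi - lo) * h2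
    have hc : c = p₃ m v lo hi x := by
      rw [p₃, eq_div_iff hD.ne']
      linear_combination (x - lo) * h2 - (x - m) ^ 2 * h1 + (x - m) ^ 2 * lo * h0
    refine ⟨?_, hb, hc⟩
    rw [p₁, ← hb, ← hc]
    linarith
  · rintro ⟨rfl, rfl, rfl⟩
    have hb : p₂ m v lo hi x * ((x - lo) * (hi - m) ^ 2 - (hi - lo) * (x - m) ^ 2) =
      (m - lo) * (hi - m) ^ 2 - v * (hi - lo) := div_mul_cancel₀ _ hD.ne'
    have hc : p₃ m v lo hi x * ((x - lo) * (hi - m) ^ 2 - (hi - lo) * (x - m) ^ 2) =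
      v * (x - lo) - (m - lo) * (x - m) ^ 2 := div_mul_cancel₀ _ hD.ne'
    refine ⟨by unfold p₁; ring, ?_, ?_⟩ <;> refine mul_right_cancel₀ hD.ne' ?_
    · unfold p₁
      linear_combination (x - lo) * hb + (hi - lo) * hc
    · linear_combination (x - m) ^ 2 * hb + (hi - m) ^ 2 * hc

theorem integral_threePointLaw {x : ℝ} (hx : x ∈ feasible m v lo hi) (g : ℝ → ℝ) :
    ∫ l, g l ∂(threePointLaw m v lo hi x) =
      p₁ m v lo hi x * g lo + p₂ m v lo hi x * g x + p₃ m v lo hi x * g hi :=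
  integral_three_dirac g hx.2.1.1 hx.2.2.1.1 hx.2.2.2.1 lo x hi

theorem threePointLaw_mem (hlo : lo < m) {x : ℝ} (hx : x ∈ feasible m v lo hi) :
    threePointLaw m v lo hi x ∈ ambiguitySet m v lo hi := by
  obtain ⟨h0, h1, h2⟩ := (moment_equations_iff (v := v) hlo hx.1.1 hx.1.2 _ _ _).2 ⟨rfl, rfl, rfl⟩
  exact threePoint_mem hlo hx.1.1 hx.1.2 hx.2.1.1 hx.2.2.1.1 hx.2.2.2.1 h0 h1 h2

/-- The equation that characterises the upper point of the law on two points. -/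
theorem upperPoint_spec (hlo : lo < m) (hv : 0 < v) :
    m < upperPoint m v lo ∧
      v * (upperPoint m v lo - lo) = (m - lo) * (upperPoint m v lo - m) ^ 2 ∧
      0 ≤ q₁ m v lo ∧ 0 ≤ q₂ m v lo ∧ q₁ m v lo + q₂ m v lo = 1 ∧
      q₁ m v lo * lo + q₂ m v lo * upperPoint m v lo = m ∧
      q₂ m v lo * (upperPoint m v lo - m) ^ 2 = v := by
  have hL : 0 < m - lo := by linarith
  have hr0 := Real.sqrt_nonneg (4 * v * (m - lo) ^ 2 + v ^ 2)
  have hr2 := Real.sq_sqrt (show 0 ≤ 4 * v * (m - lo) ^ 2 + v ^ 2 by positivity)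
  have hrv : v ≤ √(4 * v * (m - lo) ^ 2 + v ^ 2) :=
    Real.le_sqrt_of_sq_le (le_add_of_nonneg_left (by positivity))
  unfold upperPoint q₁ q₂
  generalize √(4 * v * (m - lo) ^ 2 + v ^ 2) = r at *
  obtain ⟨L, rfl⟩ : ∃ L, lo = m - L := ⟨m - lo, by ring⟩
  rw [sub_sub_cancel] at *
  have e : (2 * m * L + r + v) / (2 * L) = m + (r + v) / (2 * L) := by field_simp; ring
  rw [e]
  have hU : 0 < (r + v) / (2 * L) := by positivity
  have hk : (r + v) * ((r + v) / (2 * L)) = 2 * v * (L + (r + v) / (2 * L)) := by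
    field_simp
    linear_combination hr2
  have hq : 2 * L ^ 2 / (r + 2 * L ^ 2 + v) = L / (L + (r + v) / (2 * L)) := by
    field_simp
    ring
  have hrk : r = 2 * L * ((r + v) / (2 * L)) - v := by field_simp; ring
  rw [hq]
  generalize (r + v) / (2 * L) = U at *
  subst hrk
  have hUv : L * U ^ 2 = v * (L + U) := by linarith
  refine ⟨by linarith, by linarith, div_nonneg (by linarith) (by positivity), by positivity,
    ?_, ?_, ?_⟩
  · field_simp
    linear_combination 2 * hUv
  · field_simp
    linear_combination 2 * (m - L) * hUv
  · rw [add_sub_cancel_left]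
    field_simp
    linarith

theorem semivariance_slack_nonneg (hlo : lo < m) (hv : 0 < v) {x : ℝ} (hx : m ≤ x)
    (hxu : x ≤ upperPoint m v lo) : 0 ≤ v * (x - lo) - (m - lo) * (x - m) ^ 2 := by
  obtain ⟨hu, hu', -⟩ := upperPoint_spec hlo hv
  generalize upperPoint m v lo = u at *
  refine nonneg_of_mul_nonneg_left (b := u - lo) ?_ (by linarith)
  have e : (v * (x - lo) - (m - lo) * (x - m) ^ 2) * (u - lo) =
      (m - lo) * ((u - x) * ((m - lo) * (u + x - 2 * m) + (u - m) * (x - m))) := by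
    linear_combination (x - lo) * hu'
  rw [e]
  exact mul_nonneg (by linarith) (mul_nonneg (by linarith) (add_nonneg
    (mul_nonneg (by linarith) (by linarith)) (mul_nonneg (by linarith) (by linarith))))

theorem upperPoint_lt (hlo : lo < m) (hhi : m < hi)
    (hv : v ∈ Ioo 0 ((hi - m) ^ 2 * (m - lo) / (hi - lo))) : upperPoint m v lo < hi := by
  by_contra! h
  have h1 := semivariance_slack_nonneg hlo hv.1 hhi.le h
  have h2 := (lt_div_iff₀ (by linarith)).1 hv.2
  linarith

theorem mem_feasible (hlo : lo < m) (hhi : m < hi)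
    (hv : v ∈ Ioo 0 ((hi - m) ^ 2 * (m - lo) / (hi - lo))) {x : ℝ}
    (hx : x ∈ Icc m (upperPoint m v lo)) : x ∈ feasible m v lo hi := by
  have hxhi := hx.2.trans_lt (upperPoint_lt hlo hhi hv)
  have hD := threePoint_den_pos hlo hx.1 hxhi
  have h2 : 0 ≤ p₂ m v lo hi x := by
    refine div_nonneg ?_ hD.le
    have := (lt_div_iff₀ (by linarith)).1 hv.2
    linarith
  have h3 : 0 ≤ p₃ m v lo hi x := div_nonneg (semivariance_slack_nonneg hlo hv.1 hx.1 hx.2) hD.le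
  obtain ⟨e0, e1, -⟩ := (moment_equations_iff (v := v) hlo hx.1 hxhi _ _ _).2 ⟨rfl, rfl, rfl⟩
  have h1 : 0 ≤ p₁ m v lo hi x := by
    refine nonneg_of_mul_nonneg_left (b := m - lo) ?_ (by linarith)
    have : p₁ m v lo hi x * (m - lo) =
        p₂ m v lo hi x * (x - m) + p₃ m v lo hi x * (hi - m) := by
      linear_combination m * e0 - e1
    rw [this]
    exact add_nonneg (mul_nonneg h2 (by linarith [hx.1])) (mul_nonneg h3 (by linarith))
  exact ⟨⟨hx.1, hxhi⟩, ⟨h1, by linarith⟩, ⟨h2, by linarith⟩, ⟨h3, by linarith⟩⟩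

theorem p₃_upperPoint (hlo : lo < m) (hv : 0 < v) : p₃ m v lo hi (upperPoint m v lo) = 0 := by
  rw [p₃, (upperPoint_spec hlo hv).2.1, sub_self, zero_div]

theorem twoPointLaw_mem (hlo : lo < m) (hhi : m < hi)
    (hv : v ∈ Ioo 0 ((hi - m) ^ 2 * (m - lo) / (hi - lo))) :
    twoPointLaw m v lo ∈ ambiguitySet m v lo hi := by
  obtain ⟨hu, -, h1, h2, e0, e1, e2⟩ := upperPoint_spec hlo hv.1
  have := threePoint_mem (hi := hi) hlo hu.le (upperPoint_lt hlo hhi hv) h1 h2 le_rfl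
    (by linarith) (by linarith) (by linarith [e2])
  simpa [twoPointLaw] using this

theorem integrable_of_mem_ambiguitySet {P : Measure ℝ} (hP : P ∈ ambiguitySet m v lo hi)
    {g : ℝ → ℝ} (hg : ContinuousOn g (Icc lo hi)) : Integrable g P := by
  have := hP.1
  have h := hg.integrableOn_compact (μ := P) isCompact_Icc
  rwa [IntegrableOn, Measure.restrict_eq_self_of_ae_mem] at h
  exact hP.2.1

/-- Weak duality. -/
theorem integral_le_of_majorant {P : Measure ℝ} (hP : P ∈ ambiguitySet m v lo hi) {g : ℝ → ℝ}
    (hg : ContinuousOn g (Icc lo hi)) {a b c : ℝ}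
    (hle : ∀ y ∈ Icc lo hi, g y ≤ a + b * (y - lo) + c * (max (y - m) 0) ^ 2) :
    ∫ y, g y ∂P ≤ a + b * (m - lo) + c * v := by
  have hI : ∀ {f : ℝ → ℝ}, Continuous f → Integrable f P := fun hf =>
    integrable_of_mem_ambiguitySet hP hf.continuousOn
  have hprob := hP.1
  have h1 : ∫ y, (a + b * (y - lo) + c * (max (y - m) 0) ^ 2) ∂P = a + b * (m - lo) + c * v := by
    rw [integral_add (hI (by fun_prop)) (hI (by fun_prop)),
      integral_add (hI (by fun_prop)) (hI (by fun_prop)), integral_const_mul, integral_const_mul,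
      integral_sub (hI (by fun_prop)) (hI (by fun_prop)), hP.2.2.1, hP.2.2.2]
    simp
  rw [← h1]
  refine integral_mono_ae (integrable_of_mem_ambiguitySet hP hg) (hI (by fun_prop)) ?_
  have : ∀ᵐ y ∂P, y ∈ Icc lo hi := hP.2.1
  filter_upwards [this] with y hy using hle y hy

/-- Some three-point law is optimal. -/
theorem exists_optimal {s : ℕ} (hs : 1 ≤ s) {mu : ℝ} (hmu : 0 < mu) (hlo : 0 ≤ lo)
    (hhi : hi < s * mu) (hm : m ∈ Ioo lo hi)
    (hv : v ∈ Ioo 0 ((hi - m) ^ 2 * (m - lo) / (hi - lo))) :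
    ∃ x ∈ feasible m v lo hi, ∀ P ∈ ambiguitySet m v lo hi,
      ∫ l, W s mu l ∂P ≤ objective s mu m v lo hi x := by
  have hc : ContinuousOn (W s mu) (Icc lo hi) :=
    (continuousOn_W hs hmu).mono fun y hy => ⟨hlo.trans hy.1, hy.2.trans_lt hhi⟩
  have hsub : ∀ y ∈ Ioc lo hi, y ∈ Ioo 0 (s * mu) := fun y hy =>
    ⟨hlo.trans_lt hy.1, hy.2.trans_lt hhi⟩
  obtain ⟨x, hx, b, c, hxv, hor, hmaj⟩ := exists_dual_majorant hm.1 (upperPoint_spec hm.1 hv.1).1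
    (upperPoint_lt hm.1 hm.2 hv) hc
    (fun y hy => hasDerivAt_W hs hmu (hsub y hy))
    (fun y hy => hasDerivAt_deriv_W hs hmu (hsub y hy))
    (fun y hy => by
      have := div_mem_Ioo hmu (hsub y ⟨hy.1, hy.2.le⟩)
      exact div_pos (delayDeriv2_pos hs this.1 this.2) (by positivity))
    (fun y hy z hz hyz => by
      refine div_le_div_of_nonneg_right ?_ (by positivity)
      exact monotoneOn_delayDeriv2 hs (div_mem_Ioo hmu (hsub y ⟨hm.1.trans_le hy.1, hy.2⟩))
        (div_mem_Ioo hmu (hsub z ⟨hm.1.trans_le hz.1, hz.2⟩))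
        (div_le_div_of_nonneg_right hyz hmu.le))
  have hf := mem_feasible hm.1 hm.2 hv hx
  refine ⟨x, hf, fun P hP => (integral_le_of_majorant hP hc hmaj).trans_eq ?_⟩
  obtain ⟨e0, e1, e2⟩ := (moment_equations_iff (v := v) hm.1 hf.1.1 hf.1.2 _ _ _).2 ⟨rfl, rfl, rfl⟩
  have h3 : p₃ m v lo hi x * W s mu hi =
      p₃ m v lo hi x * (W s mu lo + b * (hi - lo) + c * (hi - m) ^ 2) := by
    rcases hor with h | rfl
    · rw [h]
    · rw [p₃_upperPoint hm.1 hv.1, zero_mul, zero_mul]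
  rw [objective, h3, hxv]
  linear_combination (-W s mu lo + b * lo) * e0 - b * e1 - c * e2

end laws

end MMS

theorem theorem4 (s : ℕ) (hs : 1 ≤ s) (mu lo hi m v : ℝ) (hmu : 0 < mu)
    (hlo : 0 ≤ lo) (hhi : hi < s * mu) (hm : m ∈ Set.Ioo lo hi)
    (hv : v ∈ Set.Ioo 0 ((hi - m) ^ 2 * (m - lo) / (hi - lo))) :
    -- expected waiting times exist for all laws of the ambiguity set
    (∀ P ∈ MMS.ambiguitySet m v lo hi, MeasureTheory.Integrable (MMS.W s mu) P) ∧
    -- the three masses are the unique solution of the moment equations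
    (∀ x ∈ Set.Ico m hi, ∀ a b c : ℝ,
      (a + b + c = 1 ∧ a * lo + b * x + c * hi = m ∧
          b * (x - m) ^ 2 + c * (hi - m) ^ 2 = v) ↔
        (a = MMS.p₁ m v lo hi x ∧ b = MMS.p₂ m v lo hi x ∧ c = MMS.p₃ m v lo hi x)) ∧
    -- candidate laws belong to the ambiguity set
    (∀ x ∈ MMS.feasible m v lo hi,
      MMS.threePointLaw m v lo hi x ∈ MMS.ambiguitySet m v lo hi ∧
        ∫ l, MMS.W s mu l ∂(MMS.threePointLaw m v lo hi x) = MMS.objective s mu m v lo hi x) ∧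
    MMS.twoPointLaw m v lo ∈ MMS.ambiguitySet m v lo hi ∧
    -- the one-dimensional problem has a solution
    (∃ x₀ ∈ MMS.feasible m v lo hi,
      IsMaxOn (MMS.objective s mu m v lo hi) (MMS.feasible m v lo hi) x₀) ∧
    -- and, with any of its solutions, the tight upper bound is the larger of the two values
    (∀ x₀ ∈ MMS.feasible m v lo hi,
      IsMaxOn (MMS.objective s mu m v lo hi) (MMS.feasible m v lo hi) x₀ →
      IsGreatest {r | ∃ P ∈ MMS.ambiguitySet m v lo hi, r = ∫ l, MMS.W s mu l ∂P}
        (max (∫ l, MMS.W s mu l ∂(MMS.threePointLaw m v lo hi x₀))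
          (∫ l, MMS.W s mu l ∂(MMS.twoPointLaw m v lo)))) := by
  have hprop : ∀ x ∈ MMS.feasible m v lo hi,
      MMS.threePointLaw m v lo hi x ∈ MMS.ambiguitySet m v lo hi ∧
        ∫ l, MMS.W s mu l ∂(MMS.threePointLaw m v lo hi x) = MMS.objective s mu m v lo hi x :=
    fun x hx => ⟨MMS.threePointLaw_mem hm.1 hx, MMS.integral_threePointLaw hx _⟩
  have htwo := MMS.twoPointLaw_mem hm.1 hm.2 hv
  obtain ⟨x₁, hx₁, hopt⟩ := MMS.exists_optimal hs hmu hlo hhi hm hv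
  refine ⟨fun P hP => MMS.integrable_of_mem_ambiguitySet hP ((MMS.continuousOn_W hs hmu).mono
    fun y hy => ⟨hlo.trans hy.1, hy.2.trans_lt hhi⟩),
    fun x hx a b c => MMS.moment_equations_iff hm.1 hx.1 hx.2 a b c, hprop, htwo,
    ⟨x₁, hx₁, fun x hx => ?_⟩, fun x₀ hx₀ hmax => ?_⟩
  · exact (hprop x hx).2.symm.trans_le (hopt _ (hprop x hx).1)
  · have hle : ∀ P ∈ MMS.ambiguitySet m v lo hi,
        ∫ l, MMS.W s mu l ∂P ≤ ∫ l, MMS.W s mu l ∂(MMS.threePointLaw m v lo hi x₀) :=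
      fun P hP => by
        rw [(hprop x₀ hx₀).2]
        exact (hopt P hP).trans (hmax hx₁)
    rw [max_eq_left (hle _ htwo)]
    refine ⟨⟨_, (hprop x₀ hx₀).1, rfl⟩, ?_⟩
    rintro _ ⟨P, hP, rfl⟩
    exact hle P hP
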